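/- Let $G$ and $T$ be finite sets, let $(G,T;E)$ be a bipartite graph with real edge costs $c:E\to\mathbb{R}$ (of arbitrary sign), and let $\mathcal{M}=(T,\mathcal{I})$ be a matroid with rank function $r$. For $S\subseteq G$ let $$v(S)=\max\Big\{\sum_{e\in M}c(e)\;:\; M\subseteq E \text{ is a matching},\ \delta_G(M)\subseteq S,\ \delta_T(M)\in\mathcal{I}\Big\},$$ where $\delta_G(M)$ and $\delta_T(M)$ denote the sets of endpoints of $M$ in $G$ and in $T$; such a function $v:2^G\to\mathbb{R}$ is called a Rado valuation. For $x\in[0,1]^G$ let $$\nu(x)=\max\Big\{\sum_{(j,k)\in E}c_{jk}z_{jk}\;:\; z\in\mathbb{R}^E,\ z\ge 0,\ \sum_{k:(j,k)\in E}z_{jk}\le x_j\ \ \forall j\in G,\ \sum_{(j,k)\in E,\,k\in A}z_{jk}\le r(A)\ \ \forall A\subseteq T\Big\},$$ and let $$\bar v(x)=\inf\Big\{\sum_{j\in G}p_jx_j+\alpha\;:\;p\in\mathbb{R}^G,\ \alpha\in\mathbb{R},\ \sum_{j\in S}p_j+\alpha\ge v(S)\ \ \forall S\subseteq G\Big\}$$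 be the concave closure of $v$. Then the maxima defining $v(S)$ and $\nu(x)$ are attained, the infimum defining $\bar v(x)$ is finite, and: 1. $\nu(x)=\bar v(x)$ for every $x\in[0,1]^G$, and $\nu(\chi_S)=v(S)$ for every $S\subseteq G$, where $\chi_S\in\{0,1\}^G$ is the characteristic vector of $S$; that is, $\nu$ is the concave extension of $v$. 2. $\nu:[0,1]^G\to\mathbb{R}$ is continuous and nonnegative, and $\nu(0)=0$. 3. $\nu$ is monotone ($\nu(x)\le\nu(y)$ for $x\le y$ in $[0,1]^G$), concave on $[0,1]^G$, and subadditive ($\nu(x+y)\le\nu(x)+\nu(y)$ for all $x,y\in[0,1]^G$ with $x+y\in[0,1]^G$). -/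

import Mathlib

/-- The data representing a Rado valuation on the items `G`: a bipartite graph `(G, T; edges)`,
a cost for every edge (values of `cost` outside `edges` are never used), and a matroid with
ground set `T`. -/
structure RadoData (G T : Type*) where
  edges : Finset (G × T)
  cost : G × T → ℝ
  matroid : Matroid T
  ground_eq : matroid.E = Set.univ

namespace RadoData

variable {G T : Type*}

/-- `F` is a matching of the bipartite graph whose set of endpoints in `G` is contained in `S`
and whose set of endpoints in `T` is independent in the matroid. -/
def IsIndepMatching (R : RadoData G T) (S : Finset G) (F : Finset (G × T)) : Prop :=
  F ⊆ R.edges ∧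
  Set.InjOn Prod.fst (F : Set (G × T)) ∧ Set.InjOn Prod.snd (F : Set (G × T)) ∧
  Prod.fst '' (F : Set (G × T)) ⊆ (S : Set G) ∧
  R.matroid.Indep (Prod.snd '' (F : Set (G × T)))

/-- The costs of the matchings that are admissible in the definition of the value of `S`. -/
def matchingCosts (R : RadoData G T) (S : Finset G) : Set ℝ :=
  {w | ∃ F : Finset (G × T), R.IsIndepMatching S F ∧ w = ∑ e ∈ F, R.cost e}

/-- The Rado valuation: the maximum cost of an admissible matching. -/
noncomputable def val (R : RadoData G T) (S : Finset G) : ℝ := sSup (R.matchingCosts S)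

/-- The rank function of the matroid on the (finite) set `T`. -/
noncomputable def rank (R : RadoData G T) (A : Finset T) : ℕ :=
  (R.matroid.eRk (A : Set T)).toNat

/-- The feasible region of the linear program at `x`. The variables are indexed by the edges,
so that `z` is zero on the pairs that are not edges. -/
def IsFeasible [Fintype G] [Fintype T] (R : RadoData G T) (x : G → ℝ) (z : G × T → ℝ) : Prop :=
  (∀ e, e ∉ R.edges → z e = 0) ∧
  (∀ j : G, ∑ k : T, z (j, k) ≤ x j) ∧
  (∀ A : Finset T, ∑ j : G, ∑ k ∈ A, z (j, k) ≤ (R.rank A : ℝ)) ∧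
  (∀ e, 0 ≤ z e)

/-- The objective values of the feasible solutions of the linear program at `x`. -/
def lpValues [Fintype G] [Fintype T] (R : RadoData G T) (x : G → ℝ) : Set ℝ :=
  {w | ∃ z : G × T → ℝ, R.IsFeasible x z ∧ w = ∑ e ∈ R.edges, R.cost e * z e}

/-- The optimum value `ν x` of the linear program at `x`. -/
noncomputable def lp [Fintype G] [Fintype T] (R : RadoData G T) (x : G → ℝ) : ℝ :=
  sSup (R.lpValues x)

end RadoData

/-- The values at `x` of the affine functions that majorize the set function `v`. -/
def affineMajorantValues {G : Type*} [Fintype G] (v : Finset G → ℝ) (x : G → ℝ) : Set ℝ :=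
  {w | ∃ (p : G → ℝ) (α : ℝ), (∀ S : Finset G, v S ≤ ∑ j ∈ S, p j + α) ∧
    w = ∑ j, p j * x j + α}

/-- The concave closure of the set function `v`. -/
noncomputable def concaveClosure {G : Type*} [Fintype G] (v : Finset G → ℝ) (x : G → ℝ) : ℝ :=
  sInf (affineMajorantValues v x)

/-- The characteristic vector of a set of items. -/
noncomputable def charVec {G : Type*} (S : Finset G) : G → ℝ :=
  Set.indicator (S : Set G) (fun _ => 1)

/-! Everything rests on the integrality of the polytope at the all-ones vector
(`eq_zero_or_eq_one_of_mem_extremePoints`). For a feasible `z`, the sets tight for the rank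
constraints are closed under union and intersection. Grouping the elements of `T` by the tight sets
containing them therefore gives classes with integral `z`-sum. Each tight row and each such class
that meets the fractional edges contains at least two of them. A dimension count then gives a
nonzero direction `d`, supported on fractional edges, that keeps all tight constraints tight, so `z`
is not extreme. Extreme points are thus incidence vectors of independent matchings, and by
Krein–Milman every linear objective over this polytope is bounded by its value at some matching.

Integrality gives `lp_charVec` after edges outside `S` are given cost zero. It also gives ν ≤ w for
the value w at x of any affine majorant (p, α): make p nonnegative and apply integrality to the
costs c - p. Conversely, ν is concave and agrees with v at the vertices, so Hahn–Banach separation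
yields affine majorants of v whose values at x come arbitrarily close to ν(x). Continuity and
subadditivity follow by scaling the rows of an optimal solution. -/

section Combinatorics

open Finset

/-! ### Counting: systems of fibre sums and fractional entries. -/

theorem card_mul_two_le_card_filter {ι α : Type*} [DecidableEq α] (s : Finset ι) (f : ι → α)
    (X : Finset α) (hX : ∀ a ∈ X, 2 ≤ #{e ∈ s | f e = a}) : #X * 2 ≤ #{e ∈ s | f e ∈ X} := by
  have hmaps : Set.MapsTo f (({e ∈ s | f e ∈ X} : Finset ι) : Set ι) (X : Set α) :=
    fun e he => (mem_filter.1 (mem_coe.1 he)).2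
  rw [card_eq_sum_card_fiberwise hmaps, ← smul_eq_mul]
  refine card_nsmul_le_sum _ _ _ fun a ha => (hX a ha).trans (card_le_card ?_)
  intro e he
  simp only [mem_filter] at he ⊢
  exact ⟨⟨he.1, he.2 ▸ ha⟩, he.2⟩

/-- Two families of fibre-sum equations over a set `s`, in which every prescribed fibre has at
least two elements, have a common nonzero solution supported on `s`. -/
theorem exists_ne_zero_sum_fiber_eq_zero {ι α β : Type*} [Fintype ι] [DecidableEq ι]
    [DecidableEq α] [DecidableEq β] (s : Finset ι) (hs : s.Nonempty) (f : ι → α) (g : ι → β)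
    (X : Finset α) (Y : Finset β)
    (hX : ∀ a ∈ X, 2 ≤ #{e ∈ s | f e = a}) (hY : ∀ b ∈ Y, 2 ≤ #{e ∈ s | g e = b}) :
    ∃ d : ι → ℝ, d ≠ 0 ∧ (∀ e ∉ s, d e = 0) ∧ (∀ a ∈ X, ∑ e with f e = a, d e = 0) ∧
      ∀ b ∈ Y, ∑ e with g e = b, d e = 0 := by
  let L : (ι → ℝ) →ₗ[ℝ] ((sᶜ : Finset ι) → ℝ) × (X → ℝ) × (Y → ℝ) :=
    (LinearMap.pi fun e : (sᶜ : Finset ι) => LinearMap.proj (e : ι)).prod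
      ((LinearMap.pi fun a : X => ∑ e with f e = (a : α), LinearMap.proj e).prod
        (LinearMap.pi fun b : Y => ∑ e with g e = (b : β), LinearMap.proj e))
  have hL1 (d : ι → ℝ) (e : (sᶜ : Finset ι)) : (L d).1 e = d e := rfl
  have hL2 (d : ι → ℝ) (a : X) : (L d).2.1 a = ∑ e with f e = (a : α), d e := by
    simp [L, LinearMap.sum_apply]
  have hL3 (d : ι → ℝ) (b : Y) : (L d).2.2 b = ∑ e with g e = (b : β), d e := by
    simp [L, LinearMap.sum_apply]
  by_cases hinj : Function.Injective L
  · exfalso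
    have hcardX := card_mul_two_le_card_filter s f X hX
    have hcardY := card_mul_two_le_card_filter s g Y hY
    have hleX : #{e ∈ s | f e ∈ X} ≤ #s := card_filter_le _ _
    have hleY : #{e ∈ s | g e ∈ Y} ≤ #s := card_filter_le _ _
    have hcompl : #(sᶜ) + #s = Fintype.card ι := card_compl_add_card s
    have hrank := LinearMap.finrank_le_finrank_of_injective hinj
    have hdom : Module.finrank ℝ (ι → ℝ) = Fintype.card ι := by simp
    have hcod : Module.finrank ℝ (((sᶜ : Finset ι) → ℝ) × (X → ℝ) × (Y → ℝ)) =
        #(sᶜ) + (#X + #Y) := by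
      simp only [Module.finrank_prod, Module.finrank_fintype_fun_eq_card, Fintype.card_coe]
    have hspos : 0 < #s := hs.card_pos
    -- Injectivity gives `#s ≤ #X + #Y`, while `2 * #X` and `2 * #Y` are at most `#s`. All these are
    -- equalities, so the fibres over `X`, and those over `Y`, each partition `s`.
    have hfX : ∀ e ∈ s, f e ∈ X := filter_card_eq (by omega)
    have hgY : ∀ e ∈ s, g e ∈ Y := filter_card_eq (by omega)
    have hsurj : Function.Surjective L :=
      (LinearMap.injective_iff_surjective_of_finrank_eq_finrank (by omega)).1 hinj
    -- The fibre equations are dependent, since both families add up to the sum over `s`. This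
    -- right-hand side violates the dependency: the sum over `s` would be both `#X` and `0`.
    obtain ⟨d, hd⟩ := hsurj (0, 1, 0)
    have hd1 (e : ι) (he : e ∉ s) : d e = 0 := by
      rw [← hL1 d ⟨e, mem_compl.2 he⟩, hd]; rfl
    have hd2 (a : α) (ha : a ∈ X) : ∑ e with f e = a, d e = 1 := by
      rw [← hL2 d ⟨a, ha⟩, hd]; rfl
    have hd3 (b : β) (hb : b ∈ Y) : ∑ e with g e = b, d e = 0 := by
      rw [← hL3 d ⟨b, hb⟩, hd]; rfl
    have hrestr (q : ι → Prop) [DecidablePred q] : ∑ e ∈ s with q e, d e = ∑ e with q e, d e := by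
      refine sum_subset (filter_subset_filter _ (subset_univ s))
        fun e he he' => hd1 e fun hes => he' ?_
      exact mem_filter.2 ⟨hes, (mem_filter.1 he).2⟩
    have h1 : ∑ e ∈ s, d e = #X := by
      rw [← sum_fiberwise_of_maps_to hfX, sum_congr rfl fun a ha => (hrestr _).trans (hd2 a ha)]
      simp
    have h2 : ∑ e ∈ s, d e = 0 := by
      rw [← sum_fiberwise_of_maps_to hgY, sum_congr rfl fun b hb => (hrestr _).trans (hd3 b hb)]
      simp
    have : #X = 0 := by exact_mod_cast h1.symm.trans h2
    omega
  · rw [← LinearMap.ker_eq_bot, Submodule.eq_bot_iff] at hinj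
    push Not at hinj
    obtain ⟨d, hd, hd0⟩ := hinj
    rw [LinearMap.mem_ker] at hd
    refine ⟨d, hd0, fun e he => ?_, fun a ha => ?_, fun b hb => ?_⟩
    · rw [← hL1 d ⟨e, mem_compl.2 he⟩, hd]; rfl
    · rw [← hL2 d ⟨a, ha⟩, hd]; rfl
    · rw [← hL3 d ⟨b, hb⟩, hd]; rfl

/-- If a sum of reals in `[0, 1]` is an integer and has one fractional term, then it has at least
two fractional terms. -/
theorem two_le_card_fractional {ι : Type*} [DecidableEq ι] (z : ι → ℝ) (s : Finset ι)
    (h0 : ∀ e ∈ s, 0 ≤ z e) (h1 : ∀ e ∈ s, z e ≤ 1) {n : ℤ} (hn : ∑ e ∈ s, z e = n)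
    {e₀ : ι} (he₀ : e₀ ∈ s) (h0e : 0 < z e₀) (h1e : z e₀ < 1) :
    2 ≤ #{e ∈ s | 0 < z e ∧ z e < 1} := by
  by_contra! hlt
  have hone : ∀ e ∈ s, e ≠ e₀ → z e = 0 ∨ z e = 1 := by
    intro e he hne
    by_contra! h
    have : #{e ∈ s | 0 < z e ∧ z e < 1} ≤ 1 := by omega
    refine hne (card_le_one.1 this e ?_ e₀ ?_)
    · exact mem_filter.2 ⟨he, (h0 e he).lt_of_ne' h.1, (h1 e he).lt_of_ne h.2⟩
    · exact mem_filter.2 ⟨he₀, h0e, h1e⟩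
  have hint : ∑ e ∈ s.erase e₀, z e ∈ (Int.castAddHom ℝ).range := by
    refine sum_mem fun e he => ?_
    rcases hone e (mem_of_mem_erase he) (ne_of_mem_erase he) with h | h
    · exact ⟨0, by simp [h]⟩
    · exact ⟨1, by simp [h]⟩
  obtain ⟨m, hm⟩ := hint
  have hsum := add_sum_erase s z he₀
  rw [← hm, hn] at hsum
  have hz : z e₀ = ((n - m : ℤ) : ℝ) := by
    push_cast; simp only [Int.coe_castAddHom] at hsum; linarith
  rw [hz] at h0e h1e
  have h2 : 0 < n - m := by exact_mod_cast h0e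
  have h3 : n - m < 1 := by exact_mod_cast h1e
  omega

/-! ### Uncrossing of tight sets. -/

/-- The sets on which the vector `y` attains the bound `r`. -/
noncomputable def tightSets {T : Type*} [Fintype T] (y : T → ℝ) (r : Finset T → ℕ) :
    Finset (Finset T) :=
  {A | ∑ k ∈ A, y k = r A}

/-- The tight sets that contain the element `k`. -/
noncomputable def tightSetsAt {T : Type*} [Fintype T] (y : T → ℝ) (r : Finset T → ℕ) (k : T) :
    Finset (Finset T) :=
  open scoped Classical in {A ∈ tightSets y r | k ∈ A}

section Tight

variable {T : Type*} [Fintype T] {y : T → ℝ} {r : Finset T → ℕ}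

theorem mem_tightSets {A : Finset T} : A ∈ tightSets y r ↔ ∑ k ∈ A, y k = r A := by
  simp [tightSets]

theorem mem_tightSetsAt {A : Finset T} {k : T} :
    A ∈ tightSetsAt y r k ↔ A ∈ tightSets y r ∧ k ∈ A := by
  simp [tightSetsAt]

variable [DecidableEq T]

/-- Uncrossing: `y` is modular and `r` is submodular, so tightness of `A` and `B` leaves no slack at
the intersection or the union. -/
theorem inter_union_mem_tightSets (hy : ∀ A, ∑ k ∈ A, y k ≤ r A)
    (hr : ∀ A B, r (A ∩ B) + r (A ∪ B) ≤ r A + r B) {A B : Finset T}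
    (hA : A ∈ tightSets y r) (hB : B ∈ tightSets y r) :
    A ∩ B ∈ tightSets y r ∧ A ∪ B ∈ tightSets y r := by
  rw [mem_tightSets] at *
  rw [mem_tightSets]
  have h1 := sum_union_inter (s₁ := A) (s₂ := B) (f := y)
  have h2 := hy (A ∩ B)
  have h3 := hy (A ∪ B)
  have h4 : (r (A ∩ B) + r (A ∪ B) : ℝ) ≤ r A + r B := by exact_mod_cast hr A B
  constructor <;> linarith

/-- The vector `y` has an integral sum over each class of elements that lie in the same tight
sets, provided that there are such tight sets. -/
theorem exists_int_sum_tightSetsAt_eq (hy : ∀ A, ∑ k ∈ A, y k ≤ r A) (hr0 : r ∅ = 0)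
    (hr : ∀ A B, r (A ∩ B) + r (A ∪ B) ≤ r A + r B) (k : T)
    (hk : (tightSetsAt y r k).Nonempty) :
    ∃ n : ℤ, ∑ l with tightSetsAt y r l = tightSetsAt y r k, y l = n := by
  -- The least tight set containing `k`, and below it the union `B` of the tight sets avoiding `k`.
  -- The class of `k` is `A \ B`, whose sum is `r A - r (A ∩ B)`.
  set A : Finset T := (tightSetsAt y r k).inf' hk id with hAdef
  set B : Finset T := (tightSets y r \ tightSetsAt y r k).sup id with hBdef
  have hA : A ∈ tightSets y r := by
    refine inf'_induction (p := fun A => A ∈ tightSets y r) hk id ?_ ?_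
    · exact fun C hC D hD => (inter_union_mem_tightSets hy hr hC hD).1
    · exact fun C hC => (mem_tightSetsAt.1 hC).1
  have hB : B ∈ tightSets y r := by
    refine sup_induction (p := fun A => A ∈ tightSets y r) ?_ ?_ ?_
    · simp [mem_tightSets, hr0]
    · exact fun C hC D hD => (inter_union_mem_tightSets hy hr hC hD).2
    · exact fun C hC => (mem_sdiff.1 hC).1
  have hAB := (inter_union_mem_tightSets hy hr hA hB).1
  have hclass : ({l | tightSetsAt y r l = tightSetsAt y r k} : Finset T) = A \ B := by
    ext l
    have hlA : l ∈ A ↔ ∀ C ∈ tightSetsAt y r k, l ∈ C := by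
      rw [← singleton_subset_iff, hAdef, le_inf'_iff]
      simp
    have hlB : l ∈ B ↔ ∃ C ∈ tightSets y r \ tightSetsAt y r k, l ∈ C := by
      rw [hBdef, mem_sup]; rfl
    rw [mem_filter, mem_sdiff, hlA, hlB]
    simp only [mem_univ, true_and, Finset.ext_iff, mem_sdiff, mem_tightSetsAt]
    grind
  rw [mem_tightSets] at hA hAB
  refine ⟨r A - r (A ∩ B), ?_⟩
  rw [hclass]
  have := sum_inter_add_sum_sdiff A B y
  push_cast
  linarith

/-- A vector whose sum over each class of elements lying in the same nonempty collection of tight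
sets vanishes has sum zero over each tight set. -/
theorem sum_eq_zero_of_mem_tightSets {d : T → ℝ}
    (hd : ∀ k, (tightSetsAt y r k).Nonempty →
      ∑ l with tightSetsAt y r l = tightSetsAt y r k, d l = 0)
    {A : Finset T} (hA : A ∈ tightSets y r) : ∑ k ∈ A, d k = 0 := by
  -- A tight set is a union of whole classes, because each class records membership in it.
  rw [← sum_fiberwise_of_maps_to (g := tightSetsAt y r) (t := A.image (tightSetsAt y r))
    fun k hk => mem_image_of_mem _ hk]
  refine sum_eq_zero fun t ht => ?_
  obtain ⟨k, hk, rfl⟩ := mem_image.1 ht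
  have hAk : A ∈ tightSetsAt y r k := mem_tightSetsAt.2 ⟨hA, hk⟩
  rw [← hd k ⟨A, hAk⟩]
  refine sum_congr ?_ fun _ _ => rfl
  ext l
  simp only [mem_filter, mem_univ, true_and, and_iff_right_iff_imp]
  intro h
  rw [← h] at hAk
  exact (mem_tightSetsAt.1 hAk).2

end Tight

end Combinatorics

/-! ### Affine majorants by separation. -/

section ConcaveClosure

theorem charVec_apply {G : Type*} [DecidableEq G] (S : Finset G) (j : G) :
    charVec S j = if j ∈ S then 1 else 0 := by
  simp [charVec, Set.indicator_apply]

theorem charVec_mem_Icc {G : Type*} (S : Finset G) : charVec S ∈ Set.Icc (0 : G → ℝ) 1 := by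
  classical
  constructor <;> intro j <;> simp only [charVec_apply, Pi.zero_apply, Pi.one_apply] <;>
    split_ifs <;> norm_num

variable {G : Type*} [Fintype G]

theorem sum_mul_charVec (p : G → ℝ) (S : Finset G) : ∑ j, p j * charVec S j = ∑ j ∈ S, p j := by
  classical
  simp [charVec_apply]

/-- A linear form on the unit cube is bounded by its value at a vertex. -/
theorem exists_sum_mul_le_sum (q x : G → ℝ) (hx : x ∈ Set.Icc (0 : G → ℝ) 1) :
    ∃ S : Finset G, ∑ j, q j * x j ≤ ∑ j ∈ S, q j := by
  classical
  refine ⟨Finset.univ.filter fun j => 0 < q j, ?_⟩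
  rw [Finset.sum_filter]
  refine Finset.sum_le_sum fun j _ => ?_
  have h0 : 0 ≤ x j := hx.1 j
  have h1 : x j ≤ 1 := hx.2 j
  split_ifs with h <;> nlinarith

/-- A function that is concave on the unit cube and dominates `v` at the vertices dominates the
concave closure of `v`, in the sense that it is approximated by affine majorants of `v`. -/
theorem exists_mem_affineMajorantValues_lt {v : Finset G → ℝ} {φ : (G → ℝ) → ℝ}
    (hφ : ConcaveOn ℝ (Set.Icc (0 : G → ℝ) 1) φ) (hv : ∀ S, v S ≤ φ (charVec S))
    {x : G → ℝ} (hx : x ∈ Set.Icc (0 : G → ℝ) 1) {ε : ℝ} (hε : 0 < ε) :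
    ∃ w ∈ affineMajorantValues v x, w < φ x + ε := by
  classical
  -- The hull of the graph of `v` is compact and lies in the hypograph of `φ`, hence misses the
  -- vertical ray starting at height `φ x + ε` above `x`.
  set C : Set ((G → ℝ) × ℝ) := convexHull ℝ (Set.range fun S : Finset G => (charVec S, v S))
  have hCcomp : IsCompact C := (Set.finite_range _).isCompact_convexHull (𝕜 := ℝ)
  have hCsub : C ⊆ {a | a.1 ∈ Set.Icc (0 : G → ℝ) 1 ∧ a.2 ≤ φ a.1} := by
    refine convexHull_min ?_ hφ.convex_hypograph
    rintro _ ⟨S, rfl⟩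
    exact ⟨charVec_mem_Icc S, hv S⟩
  have hdisj : Disjoint C ({x} ×ˢ Set.Ici (φ x + ε)) := by
    rw [Set.disjoint_left]
    rintro ⟨y, t⟩ hC ⟨hy, ht⟩
    obtain rfl : y = x := hy
    have h1 := (hCsub hC).2
    have h2 : φ y + ε ≤ t := ht
    simp only at h1
    linarith
  obtain ⟨f, a, b, hfa, hab, hfb⟩ := geometric_hahn_banach_compact_closed (convex_convexHull ℝ _)
    hCcomp ((convex_singleton x).prod (convex_Ici (φ x + ε)))
    (isClosed_singleton.prod isClosed_Ici) hdisj
  set β : ℝ := f (0, 1) with hβ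
  set q : G → ℝ := fun j => f (Pi.single j 1, 0) with hq
  have hf (y : G → ℝ) (t : ℝ) : f (y, t) = ∑ j, q j * y j + β * t := by
    have h1 : ((y, t) : (G → ℝ) × ℝ) =
        ∑ j, y j • ((Pi.single j 1, 0) : (G → ℝ) × ℝ) + t • ((0, 1) : (G → ℝ) × ℝ) := by
      ext i
      · simp [Prod.fst_sum, Finset.sum_apply, Pi.single_apply]
      · simp [Prod.snd_sum]
    rw [h1, map_add, map_sum, map_smul]
    simp only [map_smul, smul_eq_mul, ← hβ, mul_comm, hq]
  have hvert (S : Finset G) : ∑ j ∈ S, q j + β * v S < a := by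
    have := hfa _ (subset_convexHull ℝ _ ⟨S, rfl⟩)
    rwa [hf, sum_mul_charVec] at this
  have hray (t : ℝ) (ht : φ x + ε ≤ t) : b < ∑ j, q j * x j + β * t := by
    have := hfb (x, t) ⟨rfl, ht⟩
    rwa [hf] at this
  -- The separating hyperplane is not vertical. If `β ≤ 0`, a point of the ray at height at least `v
  -- S` would contradict the separation at a vertex `S` with `q`-value at least that of `x`.
  have hβpos : 0 < β := by
    obtain ⟨S, hS⟩ := exists_sum_mul_le_sum q x hx
    by_contra! hle
    have h1 := hray (max (φ x + ε) (v S)) (le_max_left _ _)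
    have h2 := hvert S
    have h3 := mul_le_mul_of_nonpos_left (le_max_right (φ x + ε) (v S)) hle
    linarith
  -- Solving the equation of the hyperplane at level `a` for the last coordinate gives the majorant.
  refine ⟨_, ⟨fun j => -(q j / β), a / β, fun S => ?_, rfl⟩, ?_⟩
  · have h2 := hvert S
    rw [Finset.sum_neg_distrib, ← Finset.sum_div, neg_add_eq_sub, ← sub_div, le_div_iff₀ hβpos]
    linarith
  · have h1 := hray _ le_rfl
    have h2 : ∑ j, -(q j / β) * x j = -(∑ j, q j * x j) / β := by
      rw [← Finset.sum_neg_distrib, Finset.sum_div]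
      exact Finset.sum_congr rfl fun j _ => by ring
    rw [h2, ← add_div, div_lt_iff₀ hβpos]
    linarith

end ConcaveClosure

namespace RadoData

/-! ### Independent matchings and monotonicity of the valuation. -/

section Matching

variable {G T : Type*} (R : RadoData G T)

theorem isIndepMatching_empty (S : Finset G) : R.IsIndepMatching S ∅ := by
  simp [IsIndepMatching]

variable {R}

theorem IsIndepMatching.subset {S : Finset G} {F F' : Finset (G × T)}
    (hF : R.IsIndepMatching S F) (h : F' ⊆ F) : R.IsIndepMatching S F' := by
  obtain ⟨h1, h2, h3, h4, h5⟩ := hF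
  have h' : (F' : Set (G × T)) ⊆ F := Finset.coe_subset.2 h
  exact ⟨h.trans h1, h2.mono h', h3.mono h', (Set.image_mono h').trans h4,
    h5.subset (Set.image_mono h')⟩

theorem IsIndepMatching.of_image_subset {S S' : Finset G} {F : Finset (G × T)}
    (hF : R.IsIndepMatching S F) (h : ∀ e ∈ F, e.1 ∈ S') : R.IsIndepMatching S' F := by
  obtain ⟨h1, h2, h3, h4, h5⟩ := hF
  exact ⟨h1, h2, h3, by rintro _ ⟨e, he, rfl⟩; exact h e he, h5⟩

variable [Fintype G] [Fintype T]

variable (R) in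
theorem isGreatest_val (S : Finset G) : IsGreatest (R.matchingCosts S) (R.val S) := by
  have hfin : (R.matchingCosts S).Finite := by
    refine (Set.finite_range fun F : Finset (G × T) => ∑ e ∈ F, R.cost e).subset ?_
    rintro _ ⟨F, -, rfl⟩
    exact ⟨F, rfl⟩
  have hne : (R.matchingCosts S).Nonempty := ⟨_, ∅, R.isIndepMatching_empty S, rfl⟩
  exact ⟨hne.csSup_mem hfin, fun w hw => le_csSup hfin.bddAbove hw⟩

theorem IsIndepMatching.sum_cost_le_val {S : Finset G} {F : Finset (G × T)}
    (hF : R.IsIndepMatching S F) : ∑ e ∈ F, R.cost e ≤ R.val S :=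
  (R.isGreatest_val S).2 ⟨F, hF, rfl⟩

theorem val_mono {S S' : Finset G} (h : S ⊆ S') : R.val S ≤ R.val S' := by
  obtain ⟨F, hF, hv⟩ := (R.isGreatest_val S).1
  rw [hv]
  exact (hF.of_image_subset fun e he => h (hF.2.2.2.1 ⟨e, he, rfl⟩)).sum_cost_le_val

/-- An affine majorant of the valuation may be replaced by one with nonnegative coefficients
without increasing its value on the unit cube. -/
theorem exists_nonneg_affineMajorant {x : G → ℝ} (hx : x ∈ Set.Icc (0 : G → ℝ) 1) {w : ℝ}
    (hw : w ∈ affineMajorantValues R.val x) :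
    ∃ (p : G → ℝ) (α : ℝ), 0 ≤ p ∧ (∀ S : Finset G, R.val S ≤ ∑ j ∈ S, p j + α) ∧
      ∑ j, p j * x j + α ≤ w := by
  classical
  obtain ⟨p, α, hp, rfl⟩ := hw
  -- Negative coefficients move into the constant. The bound at `S` is the old one at `S` together
  -- with all `j` where `p j < 0`, by monotonicity of the valuation; the value at `x` does not grow
  -- because `x ≤ 1`.
  refine ⟨fun j => max (p j) 0, ∑ j, min (p j) 0 + α, fun j => le_max_right _ _, fun S => ?_, ?_⟩
  · refine (val_mono (S' := S ∪ Finset.univ.filter fun j => p j < 0)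
      Finset.subset_union_left).trans ((hp _).trans ?_)
    rw [← add_assoc]
    gcongr
    rw [← Finset.sum_indicator_subset _ (Finset.subset_univ (S ∪ _)),
      ← Finset.sum_indicator_subset _ (Finset.subset_univ S), ← Finset.sum_add_distrib]
    refine Finset.sum_le_sum fun j _ => ?_
    simp only [Set.indicator_apply, Finset.mem_coe, Finset.mem_union, Finset.mem_filter,
      Finset.mem_univ, true_and]
    rcases lt_or_ge (p j) 0 with h | h
    · simp [h, h.le]
    · simp [h.not_gt, h]
  · rw [← add_assoc]
    gcongr
    rw [← Finset.sum_add_distrib]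
    refine Finset.sum_le_sum fun j _ => ?_
    have h1 : x j ≤ 1 := hx.2 j
    rcases le_total (p j) 0 with h | h
    · simp only [h, max_eq_right, min_eq_left]; nlinarith
    · simp [h]

end Matching

/-! ### Matroid rank as a natural number. -/

section Rank

variable {G T : Type*} (R : RadoData G T)

/-- Finite sets have finite rank, so the truncation in `toNat` loses nothing. -/
theorem coe_rank (A : Finset T) : (R.rank A : ℕ∞) = R.matroid.eRk (A : Set T) := by
  rw [rank, ENat.natCast_toNat]
  exact ((R.matroid.eRk_le_encard _).trans_lt A.finite_toSet.encard_lt_top).ne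

theorem rank_empty : R.rank ∅ = 0 := by
  simp [rank]

theorem rank_le_card (A : Finset T) : R.rank A ≤ A.card := by
  have := R.matroid.eRk_le_encard (A : Set T)
  rw [← coe_rank, Set.encard_coe_eq_coe_finsetCard] at this
  exact_mod_cast this

theorem indep_iff_rank_eq_card (A : Finset T) :
    R.matroid.Indep (A : Set T) ↔ R.rank A = A.card := by
  rw [Matroid.indep_iff_eRk_eq_encard_of_finite A.finite_toSet, ← coe_rank,
    Set.encard_coe_eq_coe_finsetCard]
  norm_cast

theorem rank_mono {A B : Finset T} (h : A ⊆ B) : R.rank A ≤ R.rank B := by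
  have := R.matroid.eRk_mono (Finset.coe_subset.2 h)
  simp only [← coe_rank] at this
  exact_mod_cast this

theorem rank_submodular [DecidableEq T] (A B : Finset T) :
    R.rank (A ∩ B) + R.rank (A ∪ B) ≤ R.rank A + R.rank B := by
  have := R.matroid.eRk_inter_add_eRk_union_le (A : Set T) (B : Set T)
  rw [← Finset.coe_inter, ← Finset.coe_union] at this
  simp only [← coe_rank] at this
  exact_mod_cast this

end Rank

end RadoData

namespace RadoData

variable {G T : Type*} [Fintype G] [Fintype T] {R : RadoData G T} {x : G → ℝ} {z : G × T → ℝ}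

/-! ### The feasible polytope and its optimum. -/

section Polytope

theorem sum_filter_fst_eq [DecidableEq G] (z : G × T → ℝ) (j : G) :
    ∑ e with e.1 = j, z e = ∑ k, z (j, k) := by
  rw [Finset.sum_filter, Fintype.sum_prod_type, Finset.sum_eq_single j]
  · simp
  · exact fun i _ hi => by simp [hi]
  · simp

theorem sum_filter_snd_eq (z : G × T → ℝ) (q : T → Prop) [DecidablePred q] :
    ∑ e with q e.2, z e = ∑ k with q k, ∑ j, z (j, k) := by
  rw [Finset.sum_filter, Fintype.sum_prod_type_right, Finset.sum_filter]
  refine Finset.sum_congr rfl fun k _ => ?_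
  split_ifs <;> simp

theorem IsFeasible.le (hz : R.IsFeasible x z) (e : G × T) : z e ≤ x e.1 :=
  (Finset.single_le_sum (f := fun k => z (e.1, k)) (fun k _ => hz.2.2.2 (e.1, k))
    (Finset.mem_univ e.2)).trans (hz.2.1 e.1)

theorem IsFeasible.mono {y : G → ℝ} (hz : R.IsFeasible x z) (h : x ≤ y) : R.IsFeasible y z :=
  ⟨hz.1, fun j => (hz.2.1 j).trans (h j), hz.2.2⟩

theorem isFeasible_zero (hx : 0 ≤ x) : R.IsFeasible x 0 :=
  ⟨fun _ _ => rfl, fun j => by simpa using hx j, fun A => by simp, fun _ => le_rfl⟩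

theorem IsFeasible.convexComb {y : G → ℝ} {u : G × T → ℝ} (hz : R.IsFeasible x z)
    (hu : R.IsFeasible y u) {a b : ℝ} (ha : 0 ≤ a) (hb : 0 ≤ b) (hab : a + b = 1) :
    R.IsFeasible (a • x + b • y) (a • z + b • u) := by
  refine ⟨fun e he => ?_, fun j => ?_, fun A => ?_, fun e => ?_⟩
  · simp [hz.1 e he, hu.1 e he]
  · simp only [Pi.add_apply, Pi.smul_apply, smul_eq_mul, Finset.sum_add_distrib, ← Finset.mul_sum]
    exact add_le_add (mul_le_mul_of_nonneg_left (hz.2.1 j) ha)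
      (mul_le_mul_of_nonneg_left (hu.2.1 j) hb)
  · simp only [Pi.add_apply, Pi.smul_apply, smul_eq_mul, Finset.sum_add_distrib, ← Finset.mul_sum]
    have h1 := mul_le_mul_of_nonneg_left (hz.2.2.1 A) ha
    have h2 := mul_le_mul_of_nonneg_left (hu.2.2.1 A) hb
    have h3 : a * (R.rank A : ℝ) + b * R.rank A = R.rank A := by rw [← add_mul, hab, one_mul]
    linarith
  · exact add_nonneg (mul_nonneg ha (hz.2.2.2 e)) (mul_nonneg hb (hu.2.2.2 e))

variable (R x) in
theorem convex_isFeasible : Convex ℝ {z | R.IsFeasible x z} := by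
  intro z hz u hu a b ha hb hab
  have := hz.convexComb hu ha hb hab
  rwa [← add_smul, hab, one_smul] at this

/-- Scaling the rows of a feasible point by factors in `[0, 1]`. -/
theorem IsFeasible.scale {y : G → ℝ} (hz : R.IsFeasible x z) {s : G → ℝ} (h0 : 0 ≤ s)
    (h1 : s ≤ 1) (hs : ∀ j, s j * x j ≤ y j) : R.IsFeasible y fun e => s e.1 * z e := by
  refine ⟨fun e he => by simp [hz.1 e he], fun j => ?_, fun A => ?_,
    fun e => mul_nonneg (h0 _) (hz.2.2.2 e)⟩
  · simp only [← Finset.mul_sum]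
    exact (mul_le_mul_of_nonneg_left (hz.2.1 j) (h0 j)).trans (hs j)
  · refine le_trans ?_ (hz.2.2.1 A)
    exact Finset.sum_le_sum fun j _ => Finset.sum_le_sum fun k _ =>
      mul_le_of_le_one_left (hz.2.2.2 _) (h1 j)

variable (R x) in
theorem isCompact_isFeasible : IsCompact {z | R.IsFeasible x z} := by
  refine (isCompact_Icc (a := (0 : G × T → ℝ)) (b := fun e => x e.1)).of_isClosed_subset ?_
    fun z hz => ⟨hz.2.2.2, hz.le⟩
  simp only [IsFeasible, Set.ofPred_and, Set.ofPred_forall]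
  refine .inter ?_ (.inter ?_ (.inter ?_ ?_))
  · exact isClosed_iInter fun e => isClosed_iInter fun _ =>
      isClosed_eq (by fun_prop) (by fun_prop)
  · exact isClosed_iInter fun j => isClosed_le (by fun_prop) (by fun_prop)
  · exact isClosed_iInter fun A => isClosed_le (by fun_prop) (by fun_prop)
  · exact isClosed_iInter fun e => isClosed_le (by fun_prop) (by fun_prop)

variable (R) in
theorem isGreatest_lp (hx : 0 ≤ x) : IsGreatest (R.lpValues x) (R.lp x) := by
  obtain ⟨z, hz, hmax⟩ := (R.isCompact_isFeasible x).exists_isMaxOn ⟨0, isFeasible_zero hx⟩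
    (f := fun z => ∑ e ∈ R.edges, R.cost e * z e) (by fun_prop)
  have h : IsGreatest (R.lpValues x) (∑ e ∈ R.edges, R.cost e * z e) := by
    refine ⟨⟨z, hz, rfl⟩, ?_⟩
    rintro _ ⟨u, hu, rfl⟩
    exact hmax hu
  rw [lp, h.csSup_eq]
  exact h

theorem IsFeasible.sum_cost_mul_le_lp (hx : 0 ≤ x) (hz : R.IsFeasible x z) :
    ∑ e ∈ R.edges, R.cost e * z e ≤ R.lp x :=
  (R.isGreatest_lp hx).2 ⟨z, hz, rfl⟩

variable (R) in
theorem exists_isFeasible_lp_eq (hx : 0 ≤ x) :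
    ∃ z, R.IsFeasible x z ∧ R.lp x = ∑ e ∈ R.edges, R.cost e * z e :=
  (R.isGreatest_lp hx).1

/-- The incidence vector of an admissible matching is feasible. -/
theorem IsIndepMatching.isFeasible_indicator {S : Finset G} {F : Finset (G × T)}
    (hF : R.IsIndepMatching S F) :
    R.IsFeasible (charVec S) (Set.indicator (F : Set (G × T)) 1) := by
  classical
  obtain ⟨h1, h2, h3, h4, h5⟩ := hF
  refine ⟨fun e he => ?_, fun j => ?_, fun A => ?_, fun e => ?_⟩
  · exact Set.indicator_of_notMem (fun h => he (h1 h)) _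
  · rw [← sum_filter_fst_eq]
    simp only [Set.indicator_apply, Finset.mem_coe, Pi.one_apply, Finset.sum_boole, charVec_apply]
    split_ifs with hj
    · norm_cast
      refine Finset.card_le_one.2 fun a ha b hb => ?_
      simp only [Finset.mem_filter, Finset.mem_univ, true_and] at ha hb
      exact h2 ha.2 hb.2 (ha.1.trans hb.1.symm)
    · norm_cast
      refine (Finset.card_eq_zero.2 ?_).le
      refine Finset.filter_eq_empty_iff.2 fun a ha haF => hj ?_
      rw [← (Finset.mem_filter.1 ha).2]
      exact h4 ⟨a, haF, rfl⟩
  · rw [Finset.sum_comm]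
    have := sum_filter_snd_eq (Set.indicator (F : Set (G × T)) 1) (· ∈ A)
    rw [Finset.filter_univ_mem] at this
    rw [← this]
    simp only [Set.indicator_apply, Finset.mem_coe, Pi.one_apply, Finset.sum_boole]
    norm_cast
    set F' : Finset (G × T) := Finset.filter (· ∈ F) (Finset.univ.filter fun e => e.2 ∈ A) with hF'
    have hmem (e : G × T) : e ∈ F' ↔ e.2 ∈ A ∧ e ∈ F := by simp [hF']
    have hcard : (F'.image Prod.snd).card = F'.card :=
      Finset.card_image_of_injOn fun a ha b hb =>
        h3 ((hmem a).1 ha).2 ((hmem b).1 hb).2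
    have hind : R.matroid.Indep ((F'.image Prod.snd : Finset T) : Set T) := by
      refine h5.subset ?_
      rw [Finset.coe_image]
      exact Set.image_mono fun e he => ((hmem e).1 he).2
    rw [← hcard, ← (R.indep_iff_rank_eq_card _).1 hind]
    refine R.rank_mono fun k hk => ?_
    obtain ⟨e, he, rfl⟩ := Finset.mem_image.1 hk
    exact ((hmem e).1 he).1
  · exact Set.indicator_nonneg (fun _ _ => zero_le_one) _

end Polytope

/-! ### Integrality of the extreme points. -/

section Integrality

theorem IsFeasible.sum_le_rank (hz : R.IsFeasible x z) (A : Finset T) :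
    ∑ k ∈ A, ∑ j, z (j, k) ≤ R.rank A := by
  rw [Finset.sum_comm]
  exact hz.2.2.1 A

/-- A direction along which the tight constraints remain tight can be followed for some time. -/
theorem IsFeasible.eventually_add_smul (hz : R.IsFeasible x z) {d : G × T → ℝ}
    (hd : ∀ e, z e = 0 → d e = 0)
    (hG : ∀ j, ∑ k, z (j, k) = x j → ∑ k, d (j, k) = 0)
    (hT : ∀ A ∈ tightSets (fun k => ∑ j, z (j, k)) R.rank, ∑ k ∈ A, ∑ j, d (j, k) = 0) :
    ∀ᶠ ε in nhds (0 : ℝ), R.IsFeasible x (z + ε • d) := by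
  -- A slack inequality survives small perturbations by continuity; a tight one survives because its
  -- slope is zero.
  have key (a b c : ℝ) (hab : a ≤ b) (h : a = b → c = 0) :
      ∀ᶠ ε in nhds (0 : ℝ), a + ε * c ≤ b := by
    rcases hab.eq_or_lt with h' | h'
    · simp [h h', hab]
    · have hc : Filter.Tendsto (fun ε : ℝ => a + ε * c) (nhds 0) (nhds (a + 0 * c)) :=
        (by fun_prop : Continuous fun ε : ℝ => a + ε * c).tendsto 0
      exact (hc.eventually_lt_const (by simpa using h')).mono fun _ => le_of_lt
  have e1 : ∀ᶠ ε in nhds (0 : ℝ), ∀ j, ∑ k, z (j, k) + ε * ∑ k, d (j, k) ≤ x j :=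
    Filter.eventually_all.2 fun j => key _ _ _ (hz.2.1 j) (hG j)
  have e2 : ∀ᶠ ε in nhds (0 : ℝ), ∀ A : Finset T,
      ∑ k ∈ A, ∑ j, z (j, k) + ε * ∑ k ∈ A, ∑ j, d (j, k) ≤ R.rank A :=
    Filter.eventually_all.2 fun A =>
      key _ _ _ (hz.sum_le_rank A) fun h => hT A (mem_tightSets.2 h)
  have e3 : ∀ᶠ ε in nhds (0 : ℝ), ∀ e, -z e + ε * -d e ≤ 0 :=
    Filter.eventually_all.2 fun e => key _ _ _ (by simpa using hz.2.2.2 e) fun h => by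
      rw [hd e (by linarith), neg_zero]
  filter_upwards [e1, e2, e3] with ε h1 h2 h3
  refine ⟨fun e he => ?_, fun j => ?_, fun A => ?_, fun e => ?_⟩
  · simp [hz.1 e he, hd e (hz.1 e he)]
  · simpa [Finset.sum_add_distrib, ← Finset.mul_sum] using h1 j
  · rw [Finset.sum_comm]
    simpa [Finset.sum_add_distrib, ← Finset.mul_sum] using h2 A
  · have := h3 e
    simp only [Pi.add_apply, Pi.smul_apply, smul_eq_mul]
    linarith

/-- The extreme points of the polytope of the linear program at the all-ones vector are
integral. -/
theorem eq_zero_or_eq_one_of_mem_extremePoints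
    (hz : z ∈ Set.extremePoints ℝ {z | R.IsFeasible 1 z}) (e : G × T) : z e = 0 ∨ z e = 1 := by
  classical
  by_contra! he
  obtain ⟨hzf, hext⟩ := hz
  have hzf : R.IsFeasible 1 z := hzf
  have hz0 (e : G × T) : 0 ≤ z e := hzf.2.2.2 e
  have hz1 (e : G × T) : z e ≤ 1 := hzf.le e
  set s : Finset (G × T) := {e | 0 < z e ∧ z e < 1} with hs
  have hmem (e : G × T) : e ∈ s ↔ 0 < z e ∧ z e < 1 := by simp [hs]
  set y : T → ℝ := fun k => ∑ j, z (j, k)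
  set τ : T → Finset (Finset T) := tightSetsAt y R.rank
  -- A family of edges with integral sum that meets the fractional support `s` meets it at least
  -- twice.
  have hfrac (q : G × T → Prop) [DecidablePred q] {n : ℤ} (hn : ∑ e with q e, z e = n)
      {e₀ : G × T} (he₀ : e₀ ∈ s) (hq : q e₀) : 2 ≤ (Finset.filter q s).card := by
    have := two_le_card_fractional z (Finset.univ.filter q) (fun e _ => hz0 e) (fun e _ => hz1 e)
      hn (e₀ := e₀) (by simpa using hq) ((hmem _).1 he₀).1 ((hmem _).1 he₀).2
    rwa [Finset.filter_comm] at this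
  -- Only tight rows and classes meeting `s` are imposed; on the others `d` vanishes anyway. Classes
  -- lying in no tight set carry no constraint.
  obtain ⟨d, hd0, hds, hdG, hdT⟩ := exists_ne_zero_sum_fiber_eq_zero s
    ⟨e, (hmem e).2 ⟨(hz0 e).lt_of_ne' he.1, (hz1 e).lt_of_ne he.2⟩⟩ Prod.fst (fun e => τ e.2)
    ((s.image Prod.fst).filter fun j => ∑ k, z (j, k) = 1)
    ((s.image fun e => τ e.2).filter Finset.Nonempty)
    (by
      intro j hj
      obtain ⟨hj, htight⟩ := Finset.mem_filter.1 hj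
      obtain ⟨e₀, he₀, rfl⟩ := Finset.mem_image.1 hj
      exact hfrac (fun e => e.1 = e₀.1) (n := 1)
        (by rw [Int.cast_one, ← htight]; convert sum_filter_fst_eq z e₀.1) he₀ rfl)
    (by
      intro t ht
      obtain ⟨ht, hne⟩ := Finset.mem_filter.1 ht
      obtain ⟨e₀, he₀, rfl⟩ := Finset.mem_image.1 ht
      obtain ⟨n, hn⟩ := exists_int_sum_tightSetsAt_eq hzf.sum_le_rank R.rank_empty
        R.rank_submodular e₀.2 hne
      exact hfrac (fun e => τ e.2 = τ e₀.2) (n := n)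
        (by rw [sum_filter_snd_eq z fun k => τ k = τ e₀.2, ← hn]) he₀ rfl)
  have hdG' (j : G) (hj : ∑ k, z (j, k) = 1) : ∑ k, d (j, k) = 0 := by
    rw [← sum_filter_fst_eq]
    by_cases hjs : j ∈ s.image Prod.fst
    · exact hdG j (Finset.mem_filter.2 ⟨hjs, hj⟩)
    · refine Finset.sum_eq_zero fun e he => hds e fun hes => hjs ?_
      exact Finset.mem_image.2 ⟨e, hes, (Finset.mem_filter.1 he).2⟩
  have hdT' (A : Finset T) (hA : A ∈ tightSets y R.rank) : ∑ k ∈ A, ∑ j, d (j, k) = 0 := by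
    refine sum_eq_zero_of_mem_tightSets (d := fun k => ∑ j, d (j, k)) (fun k hk => ?_) hA
    rw [← sum_filter_snd_eq d fun l => τ l = τ k]
    by_cases hks : τ k ∈ s.image fun e => τ e.2
    · exact hdT (τ k) (Finset.mem_filter.2 ⟨hks, hk⟩)
    · refine Finset.sum_eq_zero fun e he => hds e fun hes => hks ?_
      exact Finset.mem_image.2 ⟨e, hes, (Finset.mem_filter.1 he).2⟩
  have hev := hzf.eventually_add_smul (fun e he => hds e fun hes => ((hmem e).1 hes).1.ne' he)
    hdG' hdT'
  obtain ⟨δ, hδ, hball⟩ := Metric.eventually_nhds_iff.1 hev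
  have hp : R.IsFeasible 1 (z + (δ / 2) • d) :=
    hball (by rw [Real.dist_eq, sub_zero, abs_of_pos] <;> linarith)
  have hm : R.IsFeasible 1 (z + (-(δ / 2)) • d) :=
    hball (by rw [Real.dist_eq, sub_zero, abs_neg, abs_of_pos] <;> linarith)
  have hseg : z ∈ openSegment ℝ (z + (δ / 2) • d) (z + (-(δ / 2)) • d) := by
    refine ⟨1 / 2, 1 / 2, by norm_num, by norm_num, by norm_num, ?_⟩
    ext e
    simp only [Pi.add_apply, Pi.smul_apply, smul_eq_mul]
    ring
  have hzd : z + (δ / 2) • d = z := hext hp hm hseg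
  rw [add_eq_left, smul_eq_zero] at hzd
  exact hzd.elim (fun h => by linarith) hd0

/-- An extreme point of the polytope is the incidence vector of an admissible matching. -/
theorem exists_isIndepMatching_of_mem_extremePoints
    (hz : z ∈ Set.extremePoints ℝ {z | R.IsFeasible 1 z}) :
    ∃ F : Finset (G × T), R.IsIndepMatching Finset.univ F ∧
      z = Set.indicator (F : Set (G × T)) 1 := by
  classical
  have h01 := eq_zero_or_eq_one_of_mem_extremePoints hz
  have hzf : R.IsFeasible 1 z := hz.1
  set F : Finset (G × T) := {e | z e = 1} with hF
  have hmem (e : G × T) : e ∈ F ↔ z e = 1 := by simp [hF]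
  have hzF : z = Set.indicator (F : Set (G × T)) 1 := by
    ext e
    simp only [Set.indicator_apply, Finset.mem_coe, hmem]
    split_ifs with h
    · simpa using h
    · exact (h01 e).resolve_right h
  -- This closes the chain `|F| ≤ rank ≤ |image| ≤ |F|`. Equality throughout gives both injectivity
  -- on `T` and independence of the endpoints.
  have hcardF : (F.card : ℝ) ≤ R.rank (F.image Prod.snd) := by
    refine le_trans (le_of_eq ?_) (hzf.sum_le_rank (F.image Prod.snd))
    have := sum_filter_snd_eq z (· ∈ F.image Prod.snd)
    rw [Finset.filter_univ_mem] at this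
    rw [← this, ← Finset.sum_subset (s₁ := F)]
    · rw [Finset.sum_congr rfl fun e he => (hmem e).1 he]
      simp
    · exact fun e he => by simpa using ⟨e.1, he⟩
    · exact fun e _ he => (h01 e).resolve_right fun h => he ((hmem e).2 h)
  have hle1 : F.card ≤ R.rank (F.image Prod.snd) := by exact_mod_cast hcardF
  have hle2 := R.rank_le_card (F.image Prod.snd)
  have hle3 : (F.image Prod.snd).card ≤ F.card := Finset.card_image_le
  refine ⟨F, ⟨fun e he => ?_, fun a ha b hb hab => ?_, ?_, by simp, ?_⟩, hzF⟩
  · by_contra h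
    have := (hmem e).1 he
    rw [hzf.1 e h] at this
    exact zero_ne_one this
  · by_contra hne
    have hsum := hzf.2.1 a.1
    rw [← sum_filter_fst_eq] at hsum
    have hsub : ∑ e ∈ {a, b}, z e ≤ ∑ e with e.1 = a.1, z e := by
      refine Finset.sum_le_sum_of_subset_of_nonneg ?_ fun e _ _ => hzf.2.2.2 e
      intro e he
      rcases Finset.mem_insert.1 he with rfl | he
      · simp
      · rw [Finset.mem_singleton.1 he]; simp [hab]
    rw [Finset.sum_pair hne, (hmem a).1 ha, (hmem b).1 hb] at hsub
    norm_num at hsum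
    linarith
  · exact Finset.card_image_iff.1 (le_antisymm hle3 (hle1.trans hle2))
  · rw [← Finset.coe_image, indep_iff_rank_eq_card]
    omega

/-- The maximum of a linear objective over the polytope is attained at an admissible matching. -/
theorem IsFeasible.exists_isIndepMatching_sum_le (hz : R.IsFeasible 1 z) (w : G × T → ℝ) :
    ∃ F : Finset (G × T), R.IsIndepMatching Finset.univ F ∧ ∑ e, w e * z e ≤ ∑ e ∈ F, w e := by
  classical
  obtain ⟨F, hF, hmax⟩ := Set.exists_max_image {F | R.IsIndepMatching Finset.univ F}
    (fun F => ∑ e ∈ F, w e) (Set.toFinite _) ⟨∅, R.isIndepMatching_empty _⟩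
  refine ⟨F, hF, ?_⟩
  have hlin : IsLinearMap ℝ fun z : G × T → ℝ => ∑ e, w e * z e :=
    ⟨fun a b => by simp [mul_add, Finset.sum_add_distrib],
      fun c a => by simp [Finset.mul_sum, mul_left_comm]⟩
  -- By Krein–Milman it suffices to check the closed half-space at extreme points.
  have hsub : closure (convexHull ℝ (Set.extremePoints ℝ {z | R.IsFeasible 1 z})) ⊆
      {z | ∑ e, w e * z e ≤ ∑ e ∈ F, w e} := by
    refine closure_minimal (convexHull_min (fun u hu => ?_) (convex_halfSpace_le hlin _))
      (isClosed_le (by fun_prop) (by fun_prop))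
    obtain ⟨F', hF', rfl⟩ := exists_isIndepMatching_of_mem_extremePoints hu
    refine le_trans (le_of_eq ?_) (hmax F' hF')
    simp [Set.indicator_apply]
  rw [closure_convexHull_extremePoints (R.isCompact_isFeasible 1) (R.convex_isFeasible 1)] at hsub
  exact hsub hz

end Integrality

/-! ### Properties of the optimum value and comparison with the concave closure. -/

section Value

theorem lp_charVec (R : RadoData G T) (S : Finset G) : R.lp (charVec S) = R.val S := by
  classical
  have h0 : 0 ≤ charVec S := (charVec_mem_Icc S).1
  refine le_antisymm ?_ ?_
  · obtain ⟨z, hz, hv⟩ := R.exists_isFeasible_lp_eq h0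
    -- Integrality is available only at the all-ones vector. With zero cost outside `S`, edges of
    -- `F` leaving `S` can be dropped freely, and `z` vanishes there already.
    obtain ⟨F, hF, hle⟩ := (hz.mono (charVec_mem_Icc S).2).exists_isIndepMatching_sum_le
      fun e => if e.1 ∈ S then R.cost e else 0
    have hF' : R.IsIndepMatching S {e ∈ F | e.1 ∈ S} :=
      (hF.subset (Finset.filter_subset _ _)).of_image_subset fun e he => (Finset.mem_filter.1 he).2
    rw [← Finset.sum_filter] at hle
    refine le_trans (le_of_eq ?_) (hle.trans hF'.sum_cost_le_val)
    rw [hv]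
    refine (Finset.sum_subset (Finset.subset_univ _) fun e _ he => ?_).trans
      (Finset.sum_congr rfl fun e _ => ?_)
    · rw [hz.1 e he, mul_zero]
    · split_ifs with h
      · rfl
      · have := hz.le e
        rw [charVec_apply, if_neg h] at this
        rw [le_antisymm this (hz.2.2.2 e), mul_zero, mul_zero]
  · obtain ⟨F, hF, hv⟩ := (R.isGreatest_val S).1
    rw [hv]
    refine le_trans (le_of_eq ?_) (hF.isFeasible_indicator.sum_cost_mul_le_lp h0)
    rw [← Finset.sum_subset hF.1 fun e _ he => by
      rw [Set.indicator_of_notMem (by simpa using he), mul_zero]]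
    refine Finset.sum_congr rfl fun e he => ?_
    rw [Set.indicator_of_mem (by simpa using he), Pi.one_apply, mul_one]

theorem lp_nonneg (hx : 0 ≤ x) : 0 ≤ R.lp x := by
  simpa using (isFeasible_zero (R := R) hx).sum_cost_mul_le_lp hx

theorem concaveOn_lp (R : RadoData G T) : ConcaveOn ℝ (Set.Icc (0 : G → ℝ) 1) R.lp := by
  refine ⟨convex_Icc _ _, fun x hx y hy a b ha hb hab => ?_⟩
  obtain ⟨z, hz, hzv⟩ := R.exists_isFeasible_lp_eq hx.1
  obtain ⟨u, hu, huv⟩ := R.exists_isFeasible_lp_eq hy.1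
  refine le_trans (le_of_eq ?_) ((hz.convexComb hu ha hb hab).sum_cost_mul_le_lp
    (convex_Icc (0 : G → ℝ) 1 hx hy ha hb hab).1)
  rw [hzv, huv, smul_eq_mul, smul_eq_mul, Finset.mul_sum, Finset.mul_sum, ← Finset.sum_add_distrib]
  refine Finset.sum_congr rfl fun e _ => ?_
  simp only [Pi.add_apply, Pi.smul_apply, smul_eq_mul]
  ring

/-- Lowering the right-hand side of the linear program lowers its value at most by a constant
multiple of the change. -/
theorem lp_le_lp_add {y : G → ℝ} (hx : 0 ≤ x) (hy : 0 ≤ y) :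
    R.lp x ≤ R.lp y + ∑ e ∈ R.edges, |R.cost e| * max (x e.1 - y e.1) 0 := by
  obtain ⟨z, hz, hv⟩ := R.exists_isFeasible_lp_eq hx
  -- Each row shrinks just enough to fit under `y`, so the mass removed from row `j` is at most `max
  -- (x j - y j) 0`.
  set s : G → ℝ := fun j => if x j ≤ y j then 1 else y j / x j with hs
  have hsj (j : G) : 0 ≤ s j ∧ s j ≤ 1 ∧ s j * x j ≤ y j ∧
      (1 - s j) * x j ≤ max (x j - y j) 0 := by
    have h0 : 0 ≤ y j := hy j
    by_cases h : x j ≤ y j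
    · simp [hs, h]
    · have hx0 : 0 < x j := h0.trans_lt (not_le.1 h)
      have hm : y j / x j * x j = y j := div_mul_cancel₀ _ hx0.ne'
      simp only [hs, h, if_false]
      refine ⟨by positivity, (div_le_one hx0).2 (not_le.1 h).le, hm.le, ?_⟩
      rw [sub_mul, one_mul, hm]
      exact le_max_left _ _
  have hfeas := hz.scale (fun j => (hsj j).1) (fun j => (hsj j).2.1) fun j => (hsj j).2.2.1
  refine le_trans ?_ (add_le_add_left (hfeas.sum_cost_mul_le_lp hy) _)
  rw [hv, ← Finset.sum_add_distrib]
  refine Finset.sum_le_sum fun e _ => ?_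
  obtain ⟨-, h1, -, h2⟩ := hsj e.1
  have h3 : (1 - s e.1) * z e ≤ max (x e.1 - y e.1) 0 :=
    (mul_le_mul_of_nonneg_left (hz.le e) (sub_nonneg.2 h1)).trans h2
  have h4 : 0 ≤ (1 - s e.1) * z e := mul_nonneg (sub_nonneg.2 h1) (hz.2.2.2 e)
  have h5 : R.cost e * ((1 - s e.1) * z e) ≤ |R.cost e| * max (x e.1 - y e.1) 0 :=
    mul_le_mul (le_abs_self _) h3 h4 (abs_nonneg _)
  linarith

theorem lp_mono {y : G → ℝ} (hx : 0 ≤ x) (h : x ≤ y) : R.lp x ≤ R.lp y := by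
  refine (lp_le_lp_add hx (hx.trans h)).trans_eq ?_
  rw [add_eq_left]
  refine Finset.sum_eq_zero fun e _ => ?_
  rw [max_eq_right (sub_nonpos.2 (h e.1)), mul_zero]

theorem continuousOn_lp (R : RadoData G T) : ContinuousOn R.lp (Set.Icc (0 : G → ℝ) 1) := by
  intro x hx
  have hlow : Continuous fun y : G → ℝ =>
      R.lp x - ∑ e ∈ R.edges, |R.cost e| * max (x e.1 - y e.1) 0 := by fun_prop
  have hupp : Continuous fun y : G → ℝ =>
      R.lp x + ∑ e ∈ R.edges, |R.cost e| * max (y e.1 - x e.1) 0 := by fun_prop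
  have hlow' := (hlow.tendsto x).mono_left (nhdsWithin_le_nhds (s := Set.Icc (0 : G → ℝ) 1))
  have hupp' := (hupp.tendsto x).mono_left (nhdsWithin_le_nhds (s := Set.Icc (0 : G → ℝ) 1))
  simp only [sub_self, max_self, mul_zero, Finset.sum_const_zero, sub_zero, add_zero] at hlow' hupp'
  refine tendsto_of_tendsto_of_tendsto_of_le_of_le' hlow' hupp' ?_ ?_
  · filter_upwards [self_mem_nhdsWithin] with y hy
    linarith [lp_le_lp_add (R := R) hx.1 hy.1]
  · filter_upwards [self_mem_nhdsWithin] with y hy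
    exact lp_le_lp_add hy.1 hx.1

theorem lp_add_le {y : G → ℝ} (hx : 0 ≤ x) (hy : 0 ≤ y) : R.lp (x + y) ≤ R.lp x + R.lp y := by
  obtain ⟨z, hz, hv⟩ := R.exists_isFeasible_lp_eq (add_nonneg hx hy)
  -- Each row of an optimal solution at `x + y` is split in the ratio `x j : y j`. When both are
  -- zero the quotient is `0`, which is harmless.
  set s : G → ℝ := fun j => x j / (x j + y j) with hs
  have hsj (j : G) : 0 ≤ s j ∧ s j ≤ 1 ∧ s j * (x j + y j) ≤ x j ∧
      (1 - s j) * (x j + y j) ≤ y j := by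
    have h0 : 0 ≤ x j := hx j
    have h1 : 0 ≤ y j := hy j
    rcases (add_nonneg h0 h1).eq_or_lt with h | h
    · simp [hs, ← h, h0, h1]
    · have hm : s j * (x j + y j) = x j := div_mul_cancel₀ _ h.ne'
      refine ⟨by positivity, (div_le_one h).2 (by linarith), hm.le, ?_⟩
      rw [sub_mul, hm]
      linarith
  have hfx := (hz.scale (fun j => (hsj j).1) (fun j => (hsj j).2.1)
    fun j => (hsj j).2.2.1).sum_cost_mul_le_lp hx
  have hfy := (hz.scale (s := fun j => 1 - s j) (fun j => sub_nonneg.2 (hsj j).2.1)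
    (fun j => sub_le_self _ (hsj j).1) fun j => (hsj j).2.2.2).sum_cost_mul_le_lp hy
  refine le_trans (le_of_eq ?_) (add_le_add hfx hfy)
  rw [hv, ← Finset.sum_add_distrib]
  exact Finset.sum_congr rfl fun e _ => by ring

/-- The value of the linear program is below every affine majorant of the Rado valuation. -/
theorem lp_le_of_mem_affineMajorantValues (hx : x ∈ Set.Icc (0 : G → ℝ) 1) {w : ℝ}
    (hw : w ∈ affineMajorantValues R.val x) : R.lp x ≤ w := by
  classical
  obtain ⟨p, α, hp0, hp, hle⟩ := exists_nonneg_affineMajorant hx hw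
  obtain ⟨z, hz, hv⟩ := R.exists_isFeasible_lp_eq hx.1
  -- With reduced costs, the majorant bound at the endpoints of `F` makes the value of `F` at most
  -- `α`. The subtracted term is at most `∑ j, p j * x j` since `p` is nonnegative.
  obtain ⟨F, hF, hFle⟩ := (hz.mono hx.2).exists_isIndepMatching_sum_le fun e => R.cost e - p e.1
  have hF' : R.IsIndepMatching (F.image Prod.fst) F :=
    hF.of_image_subset fun e he => Finset.mem_image_of_mem _ he
  have h1 : ∑ e ∈ F, R.cost e ≤ ∑ e ∈ F, p e.1 + α := by
    refine hF'.sum_cost_le_val.trans ((hp _).trans_eq ?_)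
    rw [Finset.sum_image hF.2.1]
  have h2 : R.lp x = ∑ e, R.cost e * z e := by
    rw [hv]
    exact Finset.sum_subset (Finset.subset_univ _) fun e _ he => by rw [hz.1 e he, mul_zero]
  have h3 : ∑ e, p e.1 * z e ≤ ∑ j, p j * x j := by
    rw [Fintype.sum_prod_type]
    refine Finset.sum_le_sum fun j _ => ?_
    simp only [← Finset.mul_sum]
    exact mul_le_mul_of_nonneg_left (hz.2.1 j) (hp0 j)
  simp only [sub_mul, Finset.sum_sub_distrib] at hFle
  linarith

theorem isGLB_affineMajorantValues (hx : x ∈ Set.Icc (0 : G → ℝ) 1) :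
    IsGLB (affineMajorantValues R.val x) (R.lp x) := by
  refine ⟨fun w hw => lp_le_of_mem_affineMajorantValues hx hw, fun b hb => ?_⟩
  refine le_of_forall_pos_le_add fun ε hε => ?_
  obtain ⟨w, hw, hlt⟩ := exists_mem_affineMajorantValues_lt R.concaveOn_lp
    (fun S => (R.lp_charVec S).ge) hx hε
  exact (hb hw).trans hlt.le

theorem lp_eq_concaveClosure (hx : x ∈ Set.Icc (0 : G → ℝ) 1) :
    R.lp x = concaveClosure R.val x := by
  -- Only the existence of some majorant matters here, as `IsGLB.csInf_eq` needs a nonempty set; the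
  -- tolerance is arbitrary.
  obtain ⟨w, hw, -⟩ := exists_mem_affineMajorantValues_lt R.concaveOn_lp
    (fun S => (R.lp_charVec S).ge) hx one_pos
  exact ((isGLB_affineMajorantValues hx).csInf_eq ⟨w, hw⟩).symm

theorem lp_zero (R : RadoData G T) : R.lp 0 = 0 := by
  obtain ⟨z, hz, hv⟩ := R.exists_isFeasible_lp_eq (le_refl (0 : G → ℝ))
  rw [hv]
  exact Finset.sum_eq_zero fun e _ => by
    rw [le_antisymm (hz.le e) (hz.2.2.2 e), Pi.zero_apply, mul_zero]

end Value

end RadoData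

theorem mainTheorem3 {G T : Type*} [Fintype G] [Fintype T] (R : RadoData G T) :
    -- the maximum that defines the Rado valuation is attained
    (∀ S : Finset G, IsGreatest (R.matchingCosts S) (R.val S)) ∧
    -- the maximum that defines the linear programming value is attained
    (∀ x ∈ Set.Icc (0 : G → ℝ) 1, IsGreatest (R.lpValues x) (R.lp x)) ∧
    -- the infimum that defines the concave closure is a genuine infimum
    (∀ x ∈ Set.Icc (0 : G → ℝ) 1,
      IsGLB (affineMajorantValues R.val x) (concaveClosure R.val x)) ∧
    -- the linear programming value is the concave closure, and it extends the Rado valuation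
    (∀ x ∈ Set.Icc (0 : G → ℝ) 1, R.lp x = concaveClosure R.val x) ∧
    (∀ S : Finset G, R.lp (charVec S) = R.val S) ∧
    -- it is a continuous valuation function with nonnegative values
    ContinuousOn R.lp (Set.Icc (0 : G → ℝ) 1) ∧
    R.lp 0 = 0 ∧
    (∀ x ∈ Set.Icc (0 : G → ℝ) 1, 0 ≤ R.lp x) ∧
    -- it is monotone, concave and subadditive
    MonotoneOn R.lp (Set.Icc (0 : G → ℝ) 1) ∧
    ConcaveOn ℝ (Set.Icc (0 : G → ℝ) 1) R.lp ∧
    (∀ x ∈ Set.Icc (0 : G → ℝ) 1, ∀ y ∈ Set.Icc (0 : G → ℝ) 1,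
      x + y ∈ Set.Icc (0 : G → ℝ) 1 → R.lp (x + y) ≤ R.lp x + R.lp y) := by
  have hglb : ∀ x ∈ Set.Icc (0 : G → ℝ) 1,
      IsGLB (affineMajorantValues R.val x) (concaveClosure R.val x) := fun x hx =>
    R.lp_eq_concaveClosure hx ▸ RadoData.isGLB_affineMajorantValues hx
  exact ⟨R.isGreatest_val, fun x hx => R.isGreatest_lp hx.1, hglb,
    fun x hx => RadoData.lp_eq_concaveClosure hx, R.lp_charVec, R.continuousOn_lp, R.lp_zero,
    fun x hx => RadoData.lp_nonneg hx.1, fun x hx y _ h => RadoData.lp_mono hx.1 h,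
    R.concaveOn_lp, fun x hx y hy _ => RadoData.lp_add_le hx.1 hy.1⟩
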